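/- Write $Q=(a,b,c)$ for the integral binary quadratic form $ax^2+bxy+cy^2$, with discriminant $b^2-4ac$; it is primitive if $\gcd(a,b,c)=1$, and $[Q]$ denotes its class under substitutions from $SL_2(\mathbb Z)$. The Gauss sum of two classes of primitive forms of discriminant $D$ is the class of any primitive form $F$ of discriminant $D$ that is a direct composition of forms $f,g$ in these classes: there are integral bilinear forms $X,Y$ in $(x,y)$ and $(z,w)$ with $f(x,y)\,g(z,w)=F(X,Y)$, such that the determinant of $(X,Y)$ as a linear map of $(z,w)$ is $f(x,y)$ and as a linear map of $(x,y)$ is $g(z,w)$. For integers $x_1,\dots,x_4,y_1,\dots,y_4$, let $A$ be the cube with front face $M_1=\begin{pmatrix}x_1&x_2\\x_3&x_4\end{pmatrix}$ and back face $N_1=\begin{pmatrix}y_1&y_2\\y_3&y_4\end{pmatrix}$, and put $M_2=\begin{pmatrix}x_1&x_3\\y_1&y_3\end{pmatrix}$, $N_2=\begin{pmatrix}x_2&x_4\\y_2&y_4\end{pmatrix}$, $M_3=\begin{pmatrix}x_1&y_1\\x_2&y_2\end{pmatrix}$, $N_3=\begin{pmatrix}x_3&y_3\\x_4&y_4\end{pmatrix}$,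 $Q_i^A(x,y)=-\det(M_ix-N_iy)$. **Theorem.** Let $Q_2=(a_2,b_2,c_2)$ and $Q_3=(a_3,b_3,c_3)$ be primitive forms of the same discriminant $D$, with $a_3\neq0$. Then $b_2+b_3$ is even. Let $$x_1=\gcd\left(-a_3,-a_2,\tfrac{b_2+b_3}2\right)=\lambda_1(-a_3)+\lambda_2(-a_2)+\lambda_3\tfrac{b_2+b_3}2,\quad \lambda_i\in\mathbb Z,\qquad x_2=\lambda_2\tfrac{b_2-b_3}2-\lambda_3c_2 .$$ 1. If $a_2\ne0$, then, with $b_1=b_2+2a_2\frac{x_2}{x_1}$, $$Q_1'=\left(\frac{a_2a_3}{x_1^2},\ b_1,\ \frac{(b_1^2-D)x_1^2}{4a_2a_3}\right)$$ has integer coefficients, is primitive of discriminant $D$, and represents the Gauss sum of $[Q_2]$ and $[Q_3]$: a class is a Gauss sum of $[Q_2]$ and $[Q_3]$ if and only if it equals $[Q_1']$. If $x_1=1$, then $Q_1'$ is a Dirichlet composition of $Q_2$ and $Q_3$: $Q_1'=(a_2a_3,\,B,\,\frac{B^2-D}{4a_2a_3})$ with $B\equiv b_2 \pmod{2a_2}$,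 $B\equiv b_3\pmod{2a_3}$, $B^2\equiv D\pmod{4a_2a_3}$. 2. The numbers $$x_3=\frac{2a_2x_2+(b_2-b_3)x_1}{2a_3},\quad x_4=\frac{2c_2x_1+(b_2+b_3)x_2}{-2a_3},\quad y_1=0,\quad y_2=\frac{-a_3}{x_1},\quad y_3=\frac{-a_2}{x_1},\quad y_4=\frac{b_2+b_3}{2x_1}$$ are integers, and the cube $A$ with these entries satisfies $Q_2^A=Q_2$ and $Q_3^A=Q_3$. 3. The algorithm needs only a single gcd computation: there is one fixed straight-line program, whose instructions are integer constants, addition, subtraction, multiplication, exact division, and exactly one extended gcd of three integers (returning the gcd and arbitrary valid Bezout coefficients), which on every input $a_2,b_2,c_2,a_3,b_3,c_3$ as above computes $x_1,\dots,x_4,y_1,\dots,y_4$ and, if $a_2\neq0$, the coefficients of $Q_1'$, where the $\lambda_i$ are the coefficients returned by its extended gcd instruction. -/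

import Mathlib

/-- An integral binary quadratic form `(a, b, c)`, i.e. `a x² + b x y + c y²`. -/
@[ext]
structure BinForm where
  a : ℤ
  b : ℤ
  c : ℤ

namespace BinForm

/-- The value `Q(x, y)`. -/
def eval (Q : BinForm) (x y : ℤ) : ℤ := Q.a * x ^ 2 + Q.b * x * y + Q.c * y ^ 2

def disc (Q : BinForm) : ℤ := Q.b ^ 2 - 4 * Q.a * Q.c

/-- The coefficients have no common divisor apart from the units. -/
def IsPrimitive (Q : BinForm) : Prop := ∀ d : ℤ, d ∣ Q.a → d ∣ Q.b → d ∣ Q.c → IsUnit d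

/-- Proper equivalence: `R` arises from `Q` by a substitution from `SL₂(ℤ)`. -/
def ProperEquiv (Q R : BinForm) : Prop :=
  ∃ p q r s : ℤ, p * s - q * r = 1 ∧
    ∀ x y : ℤ, R.eval x y = Q.eval (p * x + q * y) (r * x + s * y)

theorem ProperEquiv.refl (Q : BinForm) : ProperEquiv Q Q :=
  ⟨1, 0, 0, 1, by norm_num, fun x y => by simp⟩

theorem ProperEquiv.symm {Q R : BinForm} (h : ProperEquiv Q R) : ProperEquiv R Q := by
  obtain ⟨p, q, r, s, hd, h⟩ := h
  refine ⟨s, -q, -r, p, by linarith, fun x y => ?_⟩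
  rw [h]
  congr 1
  · linear_combination (-x) * hd
  · linear_combination (-y) * hd

theorem ProperEquiv.trans {Q R S : BinForm} (h : ProperEquiv Q R) (k : ProperEquiv R S) :
    ProperEquiv Q S := by
  obtain ⟨p, q, r, s, hd, h⟩ := h
  obtain ⟨p', q', r', s', kd, k⟩ := k
  refine ⟨p * p' + q * r', p * q' + q * s', r * p' + s * r', r * q' + s * s', ?_, fun x y => ?_⟩
  · linear_combination (p' * s' - q' * r') * hd + kd
  · rw [k, h]
    congr 1 <;> ring

/-- Direct composition in the sense of Gauss: there is a bilinear substitution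
`X = a₁ x z + b₁ x w + c₁ y z + d₁ y w`, `Y = a₂ x z + b₂ x w + c₂ y z + d₂ y w` with
`f(x, y) g(z, w) = F(X, Y)`, such that the determinant of `(X, Y)` as a linear map of `(z, w)` is
`f(x, y)` and its determinant as a linear map of `(x, y)` is `g(z, w)`.
If `f`, `g`, `F` have the same nonzero discriminant, the first identity alone forces these two
determinants to be `± f` and `± g`; the composition is direct when both signs are `+`.
Comparing coefficients, the last two conditions are the equations of Gauss for the six
`2 × 2` minors of the substitution, which has coprime minors as soon as `f` is primitive. -/
def IsDirectComposition (f g F : BinForm) : Prop :=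
  ∃ a₁ b₁ c₁ d₁ a₂ b₂ c₂ d₂ : ℤ,
    (∀ x y z w : ℤ, f.eval x y * g.eval z w =
      F.eval (a₁ * x * z + b₁ * x * w + c₁ * y * z + d₁ * y * w)
        (a₂ * x * z + b₂ * x * w + c₂ * y * z + d₂ * y * w)) ∧
    (∀ x y : ℤ,
      (a₁ * x + c₁ * y) * (b₂ * x + d₂ * y) - (b₁ * x + d₁ * y) * (a₂ * x + c₂ * y) =
        f.eval x y) ∧
    (∀ z w : ℤ,
      (a₁ * z + b₁ * w) * (c₂ * z + d₂ * w) - (c₁ * z + d₁ * w) * (a₂ * z + b₂ * w) =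
        g.eval z w)

/-- `F` is a Dirichlet composition of `f = (a, b, c)` and `g = (a', b', c')`: these have the same
discriminant `D`, `gcd(a, a', (b + b')/2) = 1`, and
`F = (a a', B, (B² - D)/(4 a a'))` with `B ≡ b` mod `2a`, `B ≡ b'` mod `2a'` and
`B² ≡ D` mod `4 a a'` (`B` is determined modulo `2 a a'`). -/
structure IsDirichletComposition (f g F : BinForm) : Prop where
  disc_eq : f.disc = g.disc
  coprime : ∀ d : ℤ, d ∣ f.a → d ∣ g.a → d ∣ (f.b + g.b) / 2 → IsUnit d
  a_eq : F.a = f.a * g.a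
  b_left : F.b ≡ f.b [ZMOD 2 * f.a]
  b_right : F.b ≡ g.b [ZMOD 2 * g.a]
  b_sq : F.b ^ 2 ≡ f.disc [ZMOD 4 * f.a * g.a]
  c_eq : (F.c : ℚ) = ((F.b : ℚ) ^ 2 - f.disc) / (4 * f.a * g.a)

end BinForm

/-- Primitive forms of discriminant `D`. -/
def PrimForm (D : ℤ) : Type := {Q : BinForm // Q.IsPrimitive ∧ Q.disc = D}

instance primFormSetoid (D : ℤ) : Setoid (PrimForm D) where
  r Q R := BinForm.ProperEquiv Q.1 R.1
  iseqv := ⟨fun Q => .refl Q.1, fun h => h.symm, fun h k => h.trans k⟩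

/-- Proper equivalence classes of primitive forms of discriminant `D`: the underlying set of the
form class group. -/
def FormClass (D : ℤ) : Type := Quotient (primFormSetoid D)

/-- The class `[Q]`. -/
def FormClass.mk {D : ℤ} (Q : PrimForm D) : FormClass D := Quotient.mk (primFormSetoid D) Q

/-- `C = C₂ + C₃` under Gauss composition: some form in `C` is a direct composition of a form in
`C₂` and a form in `C₃`. -/
def FormClass.IsSum {D : ℤ} (C₂ C₃ C : FormClass D) : Prop :=
  ∃ f g F : PrimForm D, FormClass.mk f = C₂ ∧ FormClass.mk g = C₃ ∧ FormClass.mk F = C ∧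
    BinForm.IsDirectComposition f.1 g.1 F.1

/-- A `2 × 2 × 2` cube of integers with front face `x` and back face `y`. -/
@[ext]
structure Cube where
  x₁ : ℤ
  x₂ : ℤ
  x₃ : ℤ
  x₄ : ℤ
  y₁ : ℤ
  y₂ : ℤ
  y₃ : ℤ
  y₄ : ℤ

/-- The binary quadratic form `-det(M x - N y)`. -/
def faceForm (M N : Matrix (Fin 2) (Fin 2) ℤ) : BinForm where
  a := -M.det
  b := M 0 0 * N 1 1 + N 0 0 * M 1 1 - M 0 1 * N 1 0 - N 0 1 * M 1 0
  c := -N.det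

theorem faceForm_eval (M N : Matrix (Fin 2) (Fin 2) ℤ) (x y : ℤ) :
    (faceForm M N).eval x y = -(x • M - y • N).det := by
  simp only [faceForm, BinForm.eval, Matrix.det_fin_two, Matrix.sub_apply, Matrix.smul_apply,
    smul_eq_mul]
  ring

namespace Cube

/-- `Q₁ᴬ`, from the front and back faces. -/
def form₁ (A : Cube) : BinForm :=
  faceForm !![A.x₁, A.x₂; A.x₃, A.x₄] !![A.y₁, A.y₂; A.y₃, A.y₄]

/-- `Q₂ᴬ`, from the left and right faces. -/
def form₂ (A : Cube) : BinForm :=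
  faceForm !![A.x₁, A.x₃; A.y₁, A.y₃] !![A.x₂, A.x₄; A.y₂, A.y₄]

/-- `Q₃ᴬ`, from the top and bottom faces. -/
def form₃ (A : Cube) : BinForm :=
  faceForm !![A.x₁, A.y₁; A.x₂, A.y₂] !![A.x₃, A.y₃; A.x₄, A.y₄]

end Cube

/-- The nonnegative gcd of three integers. -/
def gcd₃ (u v w : ℤ) : ℤ := (Int.gcd u (Int.gcd v w : ℤ) : ℤ)

/-- `l = (λ₁, λ₂, λ₃)` are Bezout coefficients for `gcd(u, v, w)`. -/
def IsBezoutTriple (u v w : ℤ) (l : Fin 3 → ℤ) : Prop :=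
  gcd₃ u v w = l 0 * u + l 1 * v + l 2 * w

/-- The explicit formulas for the cube attached to `Q₂ = (a₂, b₂, c₂)`, `Q₃ = (a₃, b₃, c₃)` and
`l = (λ₁, λ₂, λ₃)`. Quotients are quotients of rational numbers, so that these equations
contain the integrality of the entries; only the gcd uses the integer `(b₂ + b₃)/2`. -/
structure IsArndtCube (Q₂ Q₃ : BinForm) (l : Fin 3 → ℤ) (A : Cube) : Prop where
  x₁_eq : A.x₁ = gcd₃ (-Q₃.a) (-Q₂.a) ((Q₂.b + Q₃.b) / 2)
  x₂_eq : (A.x₂ : ℚ) = l 1 * (Q₂.b - Q₃.b) / 2 - l 2 * Q₂.c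
  x₃_eq : (A.x₃ : ℚ) = (2 * Q₂.a * A.x₂ + (Q₂.b - Q₃.b) * A.x₁) / (2 * Q₃.a)
  x₄_eq : (A.x₄ : ℚ) = (2 * Q₂.c * A.x₁ + (Q₂.b + Q₃.b) * A.x₂) / (-2 * Q₃.a)
  y₁_eq : A.y₁ = 0
  y₂_eq : (A.y₂ : ℚ) = -Q₃.a / A.x₁
  y₃_eq : (A.y₃ : ℚ) = -Q₂.a / A.x₁
  y₄_eq : (A.y₄ : ℚ) = (Q₂.b + Q₃.b) / (2 * A.x₁)

/-- The explicit formulas for the composed form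
`(a₂ a₃ / x₁², b₁, (b₁² - D) x₁² / (4 a₂ a₃))` with `b₁ = b₂ + 2 a₂ x₂ / x₁`. -/
structure IsArndtForm (D : ℤ) (Q₂ Q₃ : BinForm) (x₁ x₂ : ℤ) (Q : BinForm) : Prop where
  a_eq : (Q.a : ℚ) = Q₂.a * Q₃.a / x₁ ^ 2
  b_eq : (Q.b : ℚ) = Q₂.b + 2 * Q₂.a * (x₂ / x₁)
  c_eq : (Q.c : ℚ) = (Q.b ^ 2 - D) * x₁ ^ 2 / (4 * Q₂.a * Q₃.a)

/-- Instructions of straight-line programs on integer registers. Operands are register numbers;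
results are put into new registers at the end of the register list. `gcd` is one extended gcd
computation: it yields the gcd of three registers together with Bezout coefficients. -/
inductive Instr where
  | const (n : ℤ)
  | add (i j : ℕ)
  | sub (i j : ℕ)
  | mul (i j : ℕ)
  | div (i j : ℕ)
  | gcd (i j k : ℕ)

namespace Instr

/-- Whether an instruction is a gcd computation. -/
def isGcd : Instr → Bool
  | gcd _ _ _ => true
  | _ => false

/-- Execution of one instruction, where `β` supplies the Bezout coefficients. It fails on a
missing register and on a division that is not exact or has divisor `0`. -/
def step (β : ℤ → ℤ → ℤ → Fin 3 → ℤ) (r : List ℤ) : Instr → Option (List ℤ)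
  | const n => some (r ++ [n])
  | add i j => do
      let u ← r[i]?
      let v ← r[j]?
      pure (r ++ [u + v])
  | sub i j => do
      let u ← r[i]?
      let v ← r[j]?
      pure (r ++ [u - v])
  | mul i j => do
      let u ← r[i]?
      let v ← r[j]?
      pure (r ++ [u * v])
  | div i j => do
      let u ← r[i]?
      let v ← r[j]?
      if v ≠ 0 ∧ v ∣ u then pure (r ++ [u / v]) else none
  | gcd i j k => do
      let u ← r[i]?
      let v ← r[j]?
      let w ← r[k]?
      pure (r ++ [gcd₃ u v w, β u v w 0, β u v w 1, β u v w 2])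

/-- Execution of a program on a given register list. -/
def run (β : ℤ → ℤ → ℤ → Fin 3 → ℤ) : List Instr → List ℤ → Option (List ℤ)
  | [], r => some r
  | i :: P, r => (step β r i).bind (run β P)

/-- The number of gcd computations of a program. -/
def gcdCount (P : List Instr) : ℕ := P.countP isGcd

end Instr

/-! For any cube, Gauss's identity `f(x, y) g(z, w) = F(X, Y)` holds with `f`, `g` the second and
third forms and `F` the first form with its variables exchanged. The entries, up to sign, are the
coefficients of `X` and `Y`, so their six minors encode the coefficients of `f` and `g`. Composing
two forms thus means finding a cube with prescribed minors.

With `y₁ = 0`, three of these equations make `x₁ (y₂, y₃, y₄)` equal to `(-a₃, -a₂, (b₂ + b₃)/2)`.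
Choosing `x₁` as the gcd makes the `y`'s coprime integers with `λ₁ y₂ + λ₂ y₃ + λ₃ y₄ = 1`. The
other three prescribe the minors of `(x₂, x₃, x₄)` against `(y₂, y₃, y₄)`; the normalization `λ₁ x₂
+ λ₂ x₃ + λ₃ x₄ = 0` turns them into the integral formulas of `arndtCube`. They are consistent
because the discriminants agree.

The class is unique because direct compositions of the same `f`, `g` have substitutions with the
same minors, coprime as `f` is primitive. By `exists_unimodular_of_minors_eq` the substitutions
differ by an element of `SL₂(ℤ)`, which carries one composed form to the other. -/

/-! ### Direct composition and its uniqueness -/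

/-- Two pairs of vectors with the same `2 × 2` minors, these generating the unit ideal, differ by a
substitution of determinant `1`. -/
theorem exists_unimodular_of_minors_eq {R ι : Type*} [CommRing R] [Fintype ι] {u v u' v' : ι → R}
    (h : ∀ i j, u' i * v' j - u' j * v' i = u i * v j - u j * v i) (k : ι → ι → R)
    (hk : ∑ i, ∑ j, k i j * (u i * v j - u j * v i) = 1) :
    ∃ p q r s : R, p * s - q * r = 1 ∧ (∀ i, u' i = p * u i + q * v i) ∧
      ∀ i, v' i = r * u i + s * v i := by
  -- The condition on `t` is the vanishing of all 3 × 3 minors of `(t, u, v)`. Averaging Cramer's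
  -- rule with the weights `k` then expresses `t` through `u` and `v`.
  have key : ∀ t : ι → R,
      (∀ m i j, t m * (u i * v j - u j * v i) = t i * (u m * v j - u j * v m) -
        t j * (u m * v i - u i * v m)) →
      ∀ m, t m = (∑ i, ∑ j, k i j * (t i * v j - t j * v i)) * u m +
        (∑ i, ∑ j, k i j * (u i * t j - u j * t i)) * v m := by
    intro t ht m
    calc t m = t m * ∑ i, ∑ j, k i j * (u i * v j - u j * v i) := by rw [hk, mul_one]
      _ = _ := by
        simp only [Finset.mul_sum, Finset.sum_mul, ← Finset.sum_add_distrib]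
        refine Finset.sum_congr rfl fun i _ => Finset.sum_congr rfl fun j _ => ?_
        linear_combination k i j * ht m i j
  -- Replacing the minors of `(u, v)` by those of `(u', v')` gives a determinant with a repeated
  -- column.
  have hu := key u' fun m i j => by
    linear_combination -u' m * h i j + u' i * h m j - u' j * h m i
  have hv := key v' fun m i j => by
    linear_combination -v' m * h i j + v' i * h m j - v' j * h m i
  generalize (∑ i, ∑ j, k i j * (u' i * v j - u' j * v i)) = p at hu
  generalize (∑ i, ∑ j, k i j * (u i * u' j - u j * u' i)) = q at hu
  generalize (∑ i, ∑ j, k i j * (v' i * v j - v' j * v i)) = r at hv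
  generalize (∑ i, ∑ j, k i j * (u i * v' j - u j * v' i)) = s at hv
  refine ⟨p, q, r, s, ?_, hu, hv⟩
  calc p * s - q * r = (p * s - q * r) * ∑ i, ∑ j, k i j * (u i * v j - u j * v i) := by
        rw [hk, mul_one]
    _ = ∑ i, ∑ j, k i j * (u i * v j - u j * v i) := by
        simp only [Finset.mul_sum]
        refine Finset.sum_congr rfl fun i _ => Finset.sum_congr rfl fun j _ => ?_
        have e := h i j
        rw [hu i, hu j, hv i, hv j] at e
        linear_combination k i j * e
    _ = 1 := hk

namespace BinForm

theorem IsPrimitive.exists_bezout {f : BinForm} (hf : f.IsPrimitive) :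
    ∃ k l m : ℤ, k * f.a + l * f.b + m * f.c = 1 := by
  set d : ℤ := (Int.gcd f.a (Int.gcd f.b f.c : ℤ) : ℤ) with hd
  have hr : d ∣ (Int.gcd f.b f.c : ℤ) := Int.gcd_dvd_right _ _
  have h : IsUnit d := hf d (Int.gcd_dvd_left _ _) (hr.trans (Int.gcd_dvd_left _ _))
    (hr.trans (Int.gcd_dvd_right _ _))
  have h1 : d = 1 := by
    rcases Int.isUnit_iff.mp h with h | h
    · exact h
    · omega
  have e₁ := Int.gcd_eq_gcd_ab f.a (Int.gcd f.b f.c : ℤ)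
  have e₂ := Int.gcd_eq_gcd_ab f.b f.c
  rw [← hd, h1] at e₁
  set t := Int.gcdB f.a (Int.gcd f.b f.c : ℤ)
  exact ⟨Int.gcdA f.a (Int.gcd f.b f.c : ℤ), t * Int.gcdA f.b f.c, t * Int.gcdB f.b f.c, by
    linear_combination -e₁ - t * e₂⟩

theorem IsPrimitive.exists_not_dvd_eval {f : BinForm} (hf : f.IsPrimitive) {p : ℤ}
    (hp : ¬IsUnit p) : ∃ x y : ℤ, ¬p ∣ f.eval x y := by
  by_contra! h
  have ha : p ∣ f.a := by simpa [eval] using h 1 0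
  have hc : p ∣ f.c := by simpa [eval] using h 0 1
  have hb : p ∣ f.b := by
    have := ((h 1 1).sub ha).sub hc
    have e : f.eval 1 1 - f.a - f.c = f.b := by
      simp only [eval]
      ring
    rwa [e] at this
  exact hp (hf p ha hb hc)

/-- A prime dividing all coefficients of `F` would divide every product `f(x, y) g(z, w)`, yet it
misses some value of each primitive factor. -/
theorem IsDirectComposition.isPrimitive {f g F : BinForm} (h : IsDirectComposition f g F)
    (hf : f.IsPrimitive) (hg : g.IsPrimitive) : F.IsPrimitive := by
  obtain ⟨a₁, b₁, c₁, d₁, a₂, b₂, c₂, d₂, h, -, -⟩ := h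
  intro d ha hb hc
  by_contra hd
  have hprime : ∃ p : ℤ, Prime p ∧ p ∣ d := by
    obtain ⟨p, hp, hpd⟩ := Nat.exists_prime_and_dvd (n := d.natAbs)
      (fun e => hd (Int.isUnit_iff_natAbs_eq.mpr e))
    exact ⟨p, Nat.prime_iff_prime_int.mp hp, Int.natCast_dvd.mpr hpd⟩
  obtain ⟨p, hp, hpd⟩ := hprime
  obtain ⟨x, y, hxy⟩ := hf.exists_not_dvd_eval hp.not_isUnit
  obtain ⟨z, w, hzw⟩ := hg.exists_not_dvd_eval hp.not_isUnit
  have : p ∣ f.eval x y * g.eval z w := by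
    rw [h]
    exact dvd_add (dvd_add ((hpd.trans ha).mul_right _)
      (((hpd.trans hb).mul_right _).mul_right _)) ((hpd.trans hc).mul_right _)
  exact (hp.dvd_or_dvd this).elim hxy hzw

/-- Direct compositions only depend on the classes of the two forms. -/
theorem IsDirectComposition.congr {f g f' g' F : BinForm} (h : IsDirectComposition f g F)
    (hf : ProperEquiv f f') (hg : ProperEquiv g g') : IsDirectComposition f' g' F := by
  obtain ⟨a₁, b₁, c₁, d₁, a₂, b₂, c₂, d₂, h, hl, hr⟩ := h
  obtain ⟨p, q, r, s, hd, hf⟩ := hf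
  obtain ⟨p', q', r', s', hd', hg⟩ := hg
  refine ⟨a₁ * p * p' + b₁ * p * r' + c₁ * r * p' + d₁ * r * r',
    a₁ * p * q' + b₁ * p * s' + c₁ * r * q' + d₁ * r * s',
    a₁ * q * p' + b₁ * q * r' + c₁ * s * p' + d₁ * s * r',
    a₁ * q * q' + b₁ * q * s' + c₁ * s * q' + d₁ * s * s',
    a₂ * p * p' + b₂ * p * r' + c₂ * r * p' + d₂ * r * r',
    a₂ * p * q' + b₂ * p * s' + c₂ * r * q' + d₂ * r * s',
    a₂ * q * p' + b₂ * q * r' + c₂ * s * p' + d₂ * s * r',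
    a₂ * q * q' + b₂ * q * s' + c₂ * s * q' + d₂ * s * s',
    fun x y z w => ?_, fun x y => ?_, fun z w => ?_⟩
  · rw [hf, hg, h]
    congr 1 <;> ring
  · rw [hf, ← hl]
    linear_combination ((a₁ * (p * x + q * y) + c₁ * (r * x + s * y)) *
      (b₂ * (p * x + q * y) + d₂ * (r * x + s * y)) -
      (b₁ * (p * x + q * y) + d₁ * (r * x + s * y)) *
      (a₂ * (p * x + q * y) + c₂ * (r * x + s * y))) * hd'
  · rw [hg, ← hr]
    linear_combination ((a₁ * (p' * z + q' * w) + b₁ * (r' * z + s' * w)) *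
      (c₂ * (p' * z + q' * w) + d₂ * (r' * z + s' * w)) -
      (c₁ * (p' * z + q' * w) + d₁ * (r' * z + s' * w)) *
      (a₂ * (p' * z + q' * w) + b₂ * (r' * z + s' * w))) * hd

/-- Any two direct compositions of the same forms are properly equivalent. -/
theorem IsDirectComposition.properEquiv {f g F F' : BinForm} (hf : f.IsPrimitive)
    (h : IsDirectComposition f g F) (h' : IsDirectComposition f g F') : ProperEquiv F F' := by
  obtain ⟨k, l, m, hk⟩ := hf.exists_bezout
  -- The case `p = 0` of non-divisibility.
  have hne : ∃ x y : ℤ, f.eval x y ≠ 0 := by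
    obtain ⟨x, y, hxy⟩ := hf.exists_not_dvd_eval not_isUnit_zero
    exact ⟨x, y, fun e => hxy (e ▸ dvd_refl _)⟩
  obtain ⟨a₁, b₁, c₁, d₁, a₂, b₂, c₂, d₂, h, hl, hr⟩ := h
  obtain ⟨a₁', b₁', c₁', d₁', a₂', b₂', c₂', d₂', h', hl', hr'⟩ := h'
  -- The outer coefficients of `f` and `g` are four of the minors; the middle ones are the
  -- difference and the sum of the remaining two. Hence all six minors are determined by `f` and
  -- `g`.
  have fa : f.a = a₁ * b₂ - b₁ * a₂ := by
    have := hl 1 0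
    simp only [eval] at this
    linarith
  have fc : f.c = c₁ * d₂ - d₁ * c₂ := by
    have := hl 0 1
    simp only [eval] at this
    linarith
  have fb : f.b = a₁ * d₂ - d₁ * a₂ - (b₁ * c₂ - c₁ * b₂) := by
    have := hl 1 1
    simp only [eval] at this
    linarith
  have ga : g.a = a₁ * c₂ - c₁ * a₂ := by
    have := hr 1 0
    simp only [eval] at this
    linarith
  have gc : g.c = b₁ * d₂ - d₁ * b₂ := by
    have := hr 0 1
    simp only [eval] at this
    linarith
  have gb : g.b = a₁ * d₂ - d₁ * a₂ + (b₁ * c₂ - c₁ * b₂) := by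
    have := hr 1 1
    simp only [eval] at this
    linarith
  have fa' : f.a = a₁' * b₂' - b₁' * a₂' := by
    have := hl' 1 0
    simp only [eval] at this
    linarith
  have fc' : f.c = c₁' * d₂' - d₁' * c₂' := by
    have := hl' 0 1
    simp only [eval] at this
    linarith
  have fb' : f.b = a₁' * d₂' - d₁' * a₂' - (b₁' * c₂' - c₁' * b₂') := by
    have := hl' 1 1
    simp only [eval] at this
    linarith
  have ga' : g.a = a₁' * c₂' - c₁' * a₂' := by
    have := hr' 1 0
    simp only [eval] at this
    linarith
  have gc' : g.c = b₁' * d₂' - d₁' * b₂' := by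
    have := hr' 0 1
    simp only [eval] at this
    linarith
  have gb' : g.b = a₁' * d₂' - d₁' * a₂' + (b₁' * c₂' - c₁' * b₂') := by
    have := hr' 1 1
    simp only [eval] at this
    linarith
  obtain ⟨p, q, r, s, hd, hu, hv⟩ := exists_unimodular_of_minors_eq
    (u := ![a₁, b₁, c₁, d₁]) (v := ![a₂, b₂, c₂, d₂])
    (u' := ![a₁', b₁', c₁', d₁']) (v' := ![a₂', b₂', c₂', d₂'])
    (fun i j => by
      fin_cases i <;> fin_cases j <;> simp <;> linarith)
    -- These weights make the sum of minors equal to `k * f.a + l * f.b + m * f.c = 1`.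
    (fun i j => ![![0, k, 0, l], ![0, 0, -l, 0], ![0, 0, 0, m], ![0, 0, 0, 0]] i j)
    (by
      simp [Fin.sum_univ_four]
      rw [fa, fb, fc] at hk
      linarith)
  have ua := hu 0
  have ub := hu 1
  have uc := hu 2
  have ud := hu 3
  have va := hv 0
  have vb := hv 1
  have vc := hv 2
  have vd := hv 3
  simp at ua ub uc ud va vb vc vd
  refine ProperEquiv.symm ⟨p, q, r, s, hd, fun X Y => ?_⟩
  obtain ⟨x, y, hxy⟩ := hne
  -- `(X, Y)` multiplied by `f(x, y)` is a value of the bilinear substitution.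
  set z := (b₂ * x + d₂ * y) * X - (b₁ * x + d₁ * y) * Y with hz
  set w := (a₁ * x + c₁ * y) * Y - (a₂ * x + c₂ * y) * X with hw
  have hX : a₁ * x * z + b₁ * x * w + c₁ * y * z + d₁ * y * w = f.eval x y * X := by
    rw [← hl, hz, hw]
    ring
  have hY : a₂ * x * z + b₂ * x * w + c₂ * y * z + d₂ * y * w = f.eval x y * Y := by
    rw [← hl, hz, hw]
    ring
  have e := h x y z w
  rw [hX, hY] at e
  have hX' : a₁' * x * z + b₁' * x * w + c₁' * y * z + d₁' * y * w =
      f.eval x y * (p * X + q * Y) := by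
    rw [ua, ub, uc, ud]
    linear_combination p * hX + q * hY
  have hY' : a₂' * x * z + b₂' * x * w + c₂' * y * z + d₂' * y * w =
      f.eval x y * (r * X + s * Y) := by
    rw [va, vb, vc, vd]
    linear_combination r * hX + s * hY
  have e' := h' x y z w
  rw [e, hX', hY'] at e'
  have hs : ∀ (G : BinForm) (n X Y : ℤ), G.eval (n * X) (n * Y) = n ^ 2 * G.eval X Y := by
    intro G n X Y
    simp only [eval]
    ring
  rw [hs, hs] at e'
  exact mul_left_cancel₀ (pow_ne_zero 2 hxy) e'

end BinForm

theorem FormClass.mk_eq_mk_iff {D : ℤ} {Q R : PrimForm D} :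
    FormClass.mk Q = FormClass.mk R ↔ BinForm.ProperEquiv Q.1 R.1 :=
  Quotient.eq (r := primFormSetoid D)

/-- The class of a direct composition is the only sum of the classes of the two forms. -/
theorem BinForm.IsDirectComposition.isSum_iff {D : ℤ} {f g F : PrimForm D}
    (h : BinForm.IsDirectComposition f.1 g.1 F.1) (C : FormClass D) :
    FormClass.IsSum (FormClass.mk f) (FormClass.mk g) C ↔ C = FormClass.mk F := by
  constructor
  · rintro ⟨f', g', F', hf, hg, rfl, h'⟩
    rw [FormClass.mk_eq_mk_iff] at hf hg ⊢
    exact (h'.congr hf hg).properEquiv f.2.1 h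
  · rintro rfl
    exact ⟨f, g, F, rfl, rfl, rfl, h⟩

/-! ### Cubes as compositions -/

namespace Cube

/-- The form `Q₁ᴬ(y, x)`, which is the composition of `Q₂ᴬ` and `Q₃ᴬ`. -/
def composedForm (A : Cube) : BinForm := ⟨A.form₁.c, A.form₁.b, A.form₁.a⟩

theorem isDirectComposition (A : Cube) :
    BinForm.IsDirectComposition A.form₂ A.form₃ A.composedForm := by
  refine ⟨A.x₁, -A.x₃, -A.x₂, A.x₄, A.y₁, -A.y₃, -A.y₂, A.y₄,
    fun x y z w => ?_, fun x y => ?_, fun z w => ?_⟩ <;>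
  · simp only [BinForm.eval, composedForm, form₁, form₂, form₃, faceForm, Matrix.det_fin_two_of,
      Matrix.of_apply, Matrix.cons_val', Matrix.cons_val_zero, Matrix.cons_val_one,
      Matrix.cons_val_fin_one]
    ring

theorem composedForm_disc (A : Cube) : A.composedForm.disc = A.form₂.disc := by
  simp only [BinForm.disc, composedForm, form₁, form₂, faceForm, Matrix.det_fin_two_of,
    Matrix.of_apply, Matrix.cons_val', Matrix.cons_val_zero, Matrix.cons_val_one,
    Matrix.cons_val_fin_one]
  ring

end Cube

/-! ### The explicit cube and its forms -/

theorem BinForm.even_b_add_b {Q R : BinForm} (h : Q.disc = R.disc) : 2 ∣ Q.b + R.b := by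
  have h2 : (2 : ℤ) ∣ (Q.b + R.b) * (Q.b + R.b) := by
    unfold BinForm.disc at h
    exact ⟨R.b ^ 2 + Q.b * R.b + 2 * Q.a * Q.c - 2 * R.a * R.c, by linear_combination h⟩
  exact (Int.prime_two.dvd_or_dvd h2).elim id id

theorem gcd₃_dvd (u v w : ℤ) : gcd₃ u v w ∣ u ∧ gcd₃ u v w ∣ v ∧ gcd₃ u v w ∣ w :=
  ⟨Int.gcd_dvd_left .., (Int.gcd_dvd_right ..).trans (Int.gcd_dvd_left ..),
    (Int.gcd_dvd_right ..).trans (Int.gcd_dvd_right ..)⟩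

theorem dvd_gcd₃ {d u v w : ℤ} (hu : d ∣ u) (hv : d ∣ v) (hw : d ∣ w) : d ∣ gcd₃ u v w :=
  Int.dvd_coe_gcd hu (Int.dvd_coe_gcd hv hw)

theorem gcd₃_ne_zero {u v w : ℤ} (hu : u ≠ 0) : gcd₃ u v w ≠ 0 :=
  fun h => hu (zero_dvd_iff.mp (h ▸ (gcd₃_dvd u v w).1))

/-- The cube attached to two forms and Bezout coefficients, without divisions in `x₁, …, x₄`. -/
def arndtCube (Q₂ Q₃ : BinForm) (l : Fin 3 → ℤ) : Cube where
  x₁ := gcd₃ (-Q₃.a) (-Q₂.a) ((Q₂.b + Q₃.b) / 2)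
  x₂ := l 1 * ((Q₂.b - Q₃.b) / 2) - l 2 * Q₂.c
  x₃ := -(l 0 * ((Q₂.b - Q₃.b) / 2) + l 2 * Q₃.c)
  x₄ := l 0 * Q₂.c + l 1 * Q₃.c
  y₁ := 0
  y₂ := -Q₃.a / gcd₃ (-Q₃.a) (-Q₂.a) ((Q₂.b + Q₃.b) / 2)
  y₃ := -Q₂.a / gcd₃ (-Q₃.a) (-Q₂.a) ((Q₂.b + Q₃.b) / 2)
  y₄ := (Q₂.b + Q₃.b) / 2 / gcd₃ (-Q₃.a) (-Q₂.a) ((Q₂.b + Q₃.b) / 2)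

/-- The equations between integers which determine `arndtCube`. -/
theorem arndtCube_relations {Q₂ Q₃ : BinForm} (h : Q₂.disc = Q₃.disc) (ha : Q₃.a ≠ 0)
    {l : Fin 3 → ℤ} (hl : IsBezoutTriple (-Q₃.a) (-Q₂.a) ((Q₂.b + Q₃.b) / 2) l) {A : Cube}
    (hA : A = arndtCube Q₂ Q₃ l) :
    ∃ α β : ℤ, Q₂.b + Q₃.b = 2 * β ∧ Q₂.b - Q₃.b = 2 * α ∧ A.x₁ ≠ 0 ∧
      A.x₂ = l 1 * α - l 2 * Q₂.c ∧ Q₃.a * A.x₃ = Q₂.a * A.x₂ + α * A.x₁ ∧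
      Q₃.a * A.x₄ = -(Q₂.c * A.x₁ + β * A.x₂) ∧ A.x₁ * A.y₂ = -Q₃.a ∧ A.x₁ * A.y₃ = -Q₂.a ∧
      A.x₁ * A.y₄ = β := by
  obtain ⟨β, hβ⟩ := BinForm.even_b_add_b h
  have hα : Q₂.b - Q₃.b = 2 * (β - Q₃.b) := by linarith
  have hβ' : (Q₂.b + Q₃.b) / 2 = β := by omega
  have hα' : (Q₂.b - Q₃.b) / 2 = β - Q₃.b := by omega
  generalize β - Q₃.b = α at hα hα'
  -- Equality of discriminants, written in the half difference `α` and half sum `β`.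
  have hαβ : α * β = Q₂.a * Q₂.c - Q₃.a * Q₃.c := by
    unfold BinForm.disc at h
    have hb : Q₂.b = α + β := by linarith
    have hc : Q₃.b = β - α := by linarith
    rw [hb, hc] at h
    linarith
  obtain ⟨d₁, d₂, d₃⟩ := gcd₃_dvd (-Q₃.a) (-Q₂.a) β
  have hx := gcd₃_ne_zero (v := -Q₂.a) (w := β) (neg_ne_zero.mpr ha)
  rw [hβ', IsBezoutTriple] at hl
  subst hA
  refine ⟨α, β, hβ, hα, ?_⟩
  simp only [arndtCube, hβ', hα']
  refine ⟨hx, trivial, ?_, ?_, Int.mul_ediv_cancel' d₁, Int.mul_ediv_cancel' d₂,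
    Int.mul_ediv_cancel' d₃⟩
  -- Once `x₁` is replaced by its Bezout expression, the terms in `l 1` cancel and `hαβ` leaves a
  -- multiple of `Q₃.a`.
  · rw [hl]
    linear_combination -l 2 * hαβ
  · rw [hl]
    linear_combination l 1 * hαβ

theorem isArndtCube_arndtCube {Q₂ Q₃ : BinForm} (h : Q₂.disc = Q₃.disc) (ha : Q₃.a ≠ 0)
    {l : Fin 3 → ℤ} (hl : IsBezoutTriple (-Q₃.a) (-Q₂.a) ((Q₂.b + Q₃.b) / 2) l) :
    IsArndtCube Q₂ Q₃ l (arndtCube Q₂ Q₃ l) := by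
  generalize hA : arndtCube Q₂ Q₃ l = A
  obtain ⟨α, β, hβ, hα, hx, h₂, h₃, h₄, k₂, k₃, k₄⟩ := arndtCube_relations h ha hl hA.symm
  have ha' : (Q₃.a : ℚ) ≠ 0 := mod_cast ha
  have hx' : (A.x₁ : ℚ) ≠ 0 := mod_cast hx
  qify at hβ hα h₂ h₃ h₄ k₂ k₃ k₄
  refine ⟨by rw [← hA]; rfl, ?_, ?_, ?_, by rw [← hA]; rfl, ?_, ?_, ?_⟩
  · rw [mul_div_assoc, hα, h₂]
    ring
  · rw [hα, eq_div_iff (by simpa using ha')]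
    linear_combination 2 * h₃
  · rw [hβ, eq_div_iff (by simpa using ha')]
    linear_combination -2 * h₄
  · rw [eq_div_iff hx']
    linear_combination k₂
  · rw [eq_div_iff hx']
    linear_combination k₃
  · rw [hβ, eq_div_iff (by simpa using hx')]
    linear_combination 2 * k₄

theorem arndtCube_form₂ {Q₂ Q₃ : BinForm} (h : Q₂.disc = Q₃.disc) (ha : Q₃.a ≠ 0)
    {l : Fin 3 → ℤ} (hl : IsBezoutTriple (-Q₃.a) (-Q₂.a) ((Q₂.b + Q₃.b) / 2) l) :
    (arndtCube Q₂ Q₃ l).form₂ = Q₂ := by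
  generalize hA : arndtCube Q₂ Q₃ l = A
  obtain ⟨α, β, hβ, hα, hx, h₂, h₃, h₄, k₂, k₃, k₄⟩ := arndtCube_relations h ha hl hA.symm
  have hy : A.y₁ = 0 := by rw [← hA]; rfl
  ext <;> simp [Cube.form₂, faceForm, Matrix.det_fin_two_of, hy]
  · linear_combination -k₃
  · have hb : Q₂.b = β + α := by linarith
    rw [hb]
    apply mul_left_cancel₀ hx
    linear_combination A.x₁ * k₄ + A.x₂ * k₃ - A.x₃ * k₂ + h₃
  · apply mul_left_cancel₀ hx
    linear_combination -A.x₂ * k₄ + A.x₄ * k₂ - h₄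

theorem arndtCube_form₃ {Q₂ Q₃ : BinForm} (h : Q₂.disc = Q₃.disc) (ha : Q₃.a ≠ 0)
    {l : Fin 3 → ℤ} (hl : IsBezoutTriple (-Q₃.a) (-Q₂.a) ((Q₂.b + Q₃.b) / 2) l) :
    (arndtCube Q₂ Q₃ l).form₃ = Q₃ := by
  generalize hA : arndtCube Q₂ Q₃ l = A
  obtain ⟨α, β, hβ, hα, hx, h₂, h₃, h₄, k₂, k₃, k₄⟩ := arndtCube_relations h ha hl hA.symm
  have hy : A.y₁ = 0 := by rw [← hA]; rfl
  have hb : Q₃.b = β - α := by linarith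
  have hαβ : α * β = Q₂.a * Q₂.c - Q₃.a * Q₃.c := by
    unfold BinForm.disc at h
    have hb' : Q₂.b = α + β := by linarith
    rw [hb', hb] at h
    linarith
  ext <;> simp [Cube.form₃, faceForm, Matrix.det_fin_two_of, hy]
  · linear_combination -k₂
  · rw [hb]
    apply mul_left_cancel₀ hx
    linear_combination A.x₁ * k₄ - A.x₂ * k₃ + A.x₃ * k₂ - h₃
  -- The relations give the `y`'s only after multiplication by `x₁`, and `x₃`, `x₄` only after
  -- multiplication by `Q₃.a`.
  · apply mul_left_cancel₀ (mul_ne_zero ha hx)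
    linear_combination -Q₃.a * A.x₃ * k₄ + Q₃.a * A.x₄ * k₃ - β * h₃ - Q₂.a * h₄ - A.x₁ * hαβ

theorem isArndtForm_composedForm {Q₂ Q₃ : BinForm} (h : Q₂.disc = Q₃.disc) (ha : Q₃.a ≠ 0)
    {l : Fin 3 → ℤ} (hl : IsBezoutTriple (-Q₃.a) (-Q₂.a) ((Q₂.b + Q₃.b) / 2) l)
    (ha₂ : Q₂.a ≠ 0) :
    IsArndtForm Q₂.disc Q₂ Q₃ (arndtCube Q₂ Q₃ l).x₁ (arndtCube Q₂ Q₃ l).x₂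
      (arndtCube Q₂ Q₃ l).composedForm := by
  have hdisc := (arndtCube Q₂ Q₃ l).composedForm_disc
  rw [arndtCube_form₂ h ha hl] at hdisc
  generalize hA : arndtCube Q₂ Q₃ l = A at hdisc ⊢
  obtain ⟨α, β, hβ, hα, hx, h₂, h₃, h₄, k₂, k₃, k₄⟩ := arndtCube_relations h ha hl hA.symm
  have hy : A.y₁ = 0 := by rw [← hA]; rfl
  have ea : A.composedForm.a * A.x₁ ^ 2 = Q₂.a * Q₃.a := by
    simp [Cube.composedForm, Cube.form₁, faceForm, Matrix.det_fin_two_of, hy]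
    linear_combination A.x₁ * A.y₃ * k₂ - Q₃.a * k₃
  have eb : A.composedForm.b * A.x₁ = Q₂.b * A.x₁ + 2 * Q₂.a * A.x₂ := by
    have hb : Q₂.b = α + β := by linarith
    simp [Cube.composedForm, Cube.form₁, faceForm, Matrix.det_fin_two_of, hy, hb]
    linear_combination A.x₁ * k₄ - A.x₂ * k₃ - A.x₃ * k₂ + h₃
  -- The last coefficient is forced by the discriminant and the first two.
  have ec : A.composedForm.c * (4 * Q₂.a * Q₃.a) =
      (A.composedForm.b ^ 2 - Q₂.disc) * A.x₁ ^ 2 := by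
    rw [← hdisc]
    simp only [BinForm.disc]
    linear_combination -4 * A.composedForm.c * ea
  have ha' : (Q₃.a : ℚ) ≠ 0 := mod_cast ha
  have ha₂' : (Q₂.a : ℚ) ≠ 0 := mod_cast ha₂
  have hx' : (A.x₁ : ℚ) ≠ 0 := mod_cast hx
  qify at ea eb ec
  refine ⟨?_, ?_, ?_⟩
  · rw [eq_div_iff (pow_ne_zero 2 hx'), ea]
  · field_simp
    linear_combination eb
  · rw [eq_div_iff (by positivity), ec]

/-- For `x₁ = 1` the relation for `x₃` gives a second expression of the middle coefficient: `b₂ + 2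
a₂ x₂ = b₃ + 2 a₃ x₃`. These are the two congruences. -/
theorem isDirichletComposition_composedForm {Q₂ Q₃ : BinForm} (h : Q₂.disc = Q₃.disc)
    (ha : Q₃.a ≠ 0) {l : Fin 3 → ℤ}
    (hl : IsBezoutTriple (-Q₃.a) (-Q₂.a) ((Q₂.b + Q₃.b) / 2) l) (ha₂ : Q₂.a ≠ 0)
    (hx₁ : (arndtCube Q₂ Q₃ l).x₁ = 1) :
    BinForm.IsDirichletComposition Q₂ Q₃ (arndtCube Q₂ Q₃ l).composedForm := by
  have hdisc := (arndtCube Q₂ Q₃ l).composedForm_disc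
  rw [arndtCube_form₂ h ha hl] at hdisc
  have hform := isArndtForm_composedForm h ha hl ha₂
  have hcop : ∀ d : ℤ, d ∣ Q₂.a → d ∣ Q₃.a → d ∣ (Q₂.b + Q₃.b) / 2 → IsUnit d :=
    fun d h₁ h₂ h₃ => isUnit_of_dvd_one (hx₁ ▸ dvd_gcd₃ h₂.neg_right h₁.neg_right h₃)
  generalize hA : arndtCube Q₂ Q₃ l = A at hdisc hform hx₁ ⊢
  obtain ⟨α, β, hβ, hα, hx, h₂, h₃, -⟩ := arndtCube_relations h ha hl hA.symm
  obtain ⟨ea, eb, ec⟩ := hform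
  rw [hx₁] at ea eb ec h₃
  have ea' : A.composedForm.a = Q₂.a * Q₃.a := by
    qify
    rw [ea]
    simp
  have eb' : A.composedForm.b = Q₂.b + 2 * Q₂.a * A.x₂ := by
    qify
    rw [eb]
    simp
  refine ⟨h, hcop, ea', ?_, ?_, ?_, ?_⟩
  · exact (Int.modEq_iff_dvd.mpr ⟨A.x₂, by rw [eb']; ring⟩).symm
  · exact (Int.modEq_iff_dvd.mpr ⟨A.x₃, by rw [eb']; linear_combination hα - 2 * h₃⟩).symm
  · refine (Int.modEq_iff_dvd.mpr ⟨A.composedForm.c, ?_⟩).symm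
    rw [← hdisc, BinForm.disc, ea']
    ring
  · rw [ec]
    simp

/-! ### The straight-line program -/

namespace Instr

/-- The program for `arndtCube` and its composed form. Registers `0` to `5` hold the coefficients
of the two forms, registers `14` to `17` the gcd and the Bezout coefficients; the last eleven
instructions copy the results to the end. -/
def arndtProgram : List Instr :=
  [const 2, const 0, sub 7 3, sub 7 0, add 1 4, div 10 6, sub 1 4, div 12 6, gcd 8 9 11,
    mul 16 13, mul 17 2, sub 18 19,
    mul 15 13, mul 17 5, add 21 22, sub 7 23,
    mul 15 2, mul 16 5, add 25 26,
    div 8 14, div 9 14, div 11 14,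
    mul 28 29, mul 14 30, mul 20 29, mul 24 28, sub 32 33, sub 35 34,
    mul 20 24, mul 14 27, sub 37 38,
    add 14 7, add 20 7, add 24 7, add 27 7, add 7 7, add 28 7, add 29 7, add 30 7,
    add 31 7, add 36 7, add 39 7]

variable {β : ℤ → ℤ → ℤ → Fin 3 → ℤ} {P : List Instr} {r : List ℤ} {s : Option (List ℤ)}
  {i j k : ℕ} {u v w x : ℤ}

theorem run_const_cons (n : ℤ) (h : run β P (r ++ [n]) = s) : run β (const n :: P) r = s := by
  simpa [run, step] using h

/-- The result is a separate variable `w`, so that a computed value can enter the register list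
under the name of a cube entry or form coefficient. -/
theorem run_add_cons (hi : r[i]? = some u) (hj : r[j]? = some v) (hw : u + v = w)
    (h : run β P (r ++ [w]) = s) : run β (add i j :: P) r = s := by
  simpa [run, step, hi, hj, hw] using h

theorem run_sub_cons (hi : r[i]? = some u) (hj : r[j]? = some v) (hw : u - v = w)
    (h : run β P (r ++ [w]) = s) : run β (sub i j :: P) r = s := by
  simpa [run, step, hi, hj, hw] using h

theorem run_mul_cons (hi : r[i]? = some u) (hj : r[j]? = some v) (hw : u * v = w)
    (h : run β P (r ++ [w]) = s) : run β (mul i j :: P) r = s := by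
  simpa [run, step, hi, hj, hw] using h

theorem run_div_cons (hi : r[i]? = some u) (hj : r[j]? = some v) (hv : v ≠ 0) (hd : v ∣ u)
    (hw : u / v = w) (h : run β P (r ++ [w]) = s) : run β (div i j :: P) r = s := by
  simpa [run, step, hi, hj, hw, hv, hd] using h

theorem run_gcd_cons (hi : r[i]? = some u) (hj : r[j]? = some v) (hk : r[k]? = some w)
    (h : run β P (r ++ [gcd₃ u v w, β u v w 0, β u v w 1, β u v w 2]) = s) :
    run β (gcd i j k :: P) r = s := by
  simpa [run, step, hi, hj, hk] using h

theorem run_arndtProgram (β : ℤ → ℤ → ℤ → Fin 3 → ℤ) {Q₂ Q₃ : BinForm}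
    (h : Q₂.disc = Q₃.disc) (ha : Q₃.a ≠ 0) {A : Cube}
    (hA : A = arndtCube Q₂ Q₃ (β (-Q₃.a) (-Q₂.a) ((Q₂.b + Q₃.b) / 2))) :
    ∃ r : List ℤ, run β arndtProgram [Q₂.a, Q₂.b, Q₂.c, Q₃.a, Q₃.b, Q₃.c] =
      some (r ++ [A.x₁, A.x₂, A.x₃, A.x₄, A.y₁, A.y₂, A.y₃, A.y₄,
        A.composedForm.a, A.composedForm.b, A.composedForm.c]) := by
  have hs := BinForm.even_b_add_b h
  have hd : 2 ∣ Q₂.b - Q₃.b := by omega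
  obtain ⟨d₁, d₂, d₃⟩ := gcd₃_dvd (-Q₃.a) (-Q₂.a) ((Q₂.b + Q₃.b) / 2)
  have hx := gcd₃_ne_zero (v := -Q₂.a) (w := (Q₂.b + Q₃.b) / 2) (neg_ne_zero.mpr ha)
  have hy : A.y₁ = 0 := by rw [hA]; rfl
  have e₁ : A.y₂ * A.y₃ = A.composedForm.a := by
    simp [Cube.composedForm, Cube.form₁, faceForm, Matrix.det_fin_two_of, hy]
  have e₂ : A.x₁ * A.y₄ - A.x₂ * A.y₃ - A.x₃ * A.y₂ = A.composedForm.b := by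
    simp [Cube.composedForm, Cube.form₁, faceForm, Matrix.det_fin_two_of, hy]
    ring
  have e₃ : A.x₂ * A.x₃ - A.x₁ * A.x₄ = A.composedForm.c := by
    simp [Cube.composedForm, Cube.form₁, faceForm, Matrix.det_fin_two_of]
  generalize A.composedForm = F at *
  obtain ⟨a, b, c⟩ := F
  obtain ⟨x₁, x₂, x₃, x₄, y₁, y₂, y₃, y₄⟩ := A
  simp only [arndtCube, Cube.mk.injEq] at hA e₁ e₂ e₃ hy ⊢
  obtain ⟨h₁, h₂, h₃, h₄, -, k₂, k₃, k₄⟩ := hA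
  subst hy
  rw [← h₁] at d₁ d₂ d₃ hx k₂ k₃ k₄
  -- The six inputs and all intermediate results fill registers `0` to `39`; the eleven outputs
  -- follow. The only divisors are `2` and `x₁`, so the case `Q₂.a = 0` needs no branch.
  suffices ∃ R, run β arndtProgram [Q₂.a, Q₂.b, Q₂.c, Q₃.a, Q₃.b, Q₃.c] = some R ∧
      R.drop 40 = [x₁, x₂, x₃, x₄, 0, y₂, y₃, y₄, a, b, c] by
    obtain ⟨R, hR, hd⟩ := this
    exact ⟨R.take 40, by rw [hR, ← hd, List.take_append_drop]⟩
  -- `R` stays a metavariable, filled in by executing the program symbolically.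
  apply Exists.intro
  apply And.intro
  · refine run_const_cons 2 (run_const_cons 0 ?_)
    simp only [List.cons_append, List.nil_append]
    refine run_sub_cons rfl rfl (zero_sub _) <|
      run_sub_cons rfl rfl (zero_sub _) ?_
    simp only [List.cons_append, List.nil_append]
    refine run_add_cons rfl rfl rfl <|
      run_div_cons rfl rfl two_ne_zero hs rfl ?_
    simp only [List.cons_append, List.nil_append]
    refine run_sub_cons rfl rfl rfl <|
      run_div_cons rfl rfl two_ne_zero hd rfl ?_
    simp only [List.cons_append, List.nil_append]
    refine run_gcd_cons rfl rfl rfl ?_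
    rw [← h₁]
    simp only [List.cons_append, List.nil_append]
    refine run_mul_cons rfl rfl rfl <|
      run_mul_cons rfl rfl rfl <|
      run_sub_cons rfl rfl h₂.symm ?_
    simp only [List.cons_append, List.nil_append]
    refine run_mul_cons rfl rfl rfl <|
      run_mul_cons rfl rfl rfl <|
      run_add_cons rfl rfl rfl <|
      run_sub_cons rfl rfl ((zero_sub _).trans h₃.symm) ?_
    simp only [List.cons_append, List.nil_append]
    refine run_mul_cons rfl rfl rfl <|
      run_mul_cons rfl rfl rfl <|
      run_add_cons rfl rfl h₄.symm ?_
    simp only [List.cons_append, List.nil_append]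
    refine run_div_cons rfl rfl hx d₁ k₂.symm <|
      run_div_cons rfl rfl hx d₂ k₃.symm <|
      run_div_cons rfl rfl hx d₃ k₄.symm ?_
    simp only [List.cons_append, List.nil_append]
    refine run_mul_cons rfl rfl e₁ <|
      run_mul_cons rfl rfl rfl <|
      run_mul_cons rfl rfl rfl ?_
    simp only [List.cons_append, List.nil_append]
    refine run_mul_cons rfl rfl rfl <|
      run_sub_cons rfl rfl rfl <|
      run_sub_cons rfl rfl e₂ ?_
    simp only [List.cons_append, List.nil_append]
    refine run_mul_cons rfl rfl rfl <|
      run_mul_cons rfl rfl rfl <|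
      run_sub_cons rfl rfl e₃ ?_
    simp only [List.cons_append, List.nil_append]
    iterate 11
      refine run_add_cons rfl rfl (add_zero _) ?_
      simp only [List.cons_append, List.nil_append]
    rfl
  · rfl

end Instr

/-! ### The theorem -/

theorem theorem3p3 :
    (∀ (D : ℤ) (Q₂ Q₃ : BinForm) (h₂ : Q₂.IsPrimitive ∧ Q₂.disc = D)
      (h₃ : Q₃.IsPrimitive ∧ Q₃.disc = D), Q₃.a ≠ 0 →
      ∀ l : Fin 3 → ℤ, IsBezoutTriple (-Q₃.a) (-Q₂.a) ((Q₂.b + Q₃.b) / 2) l →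
        2 ∣ Q₂.b + Q₃.b ∧
        ∃ A : Cube, IsArndtCube Q₂ Q₃ l A ∧
          A.form₂ = Q₂ ∧ A.form₃ = Q₃ ∧
          (Q₂.a ≠ 0 →
            ∃ (Q₁' : BinForm) (h₁ : Q₁'.IsPrimitive ∧ Q₁'.disc = D),
              IsArndtForm D Q₂ Q₃ A.x₁ A.x₂ Q₁' ∧
              (∀ C : FormClass D,
                FormClass.IsSum (FormClass.mk ⟨Q₂, h₂⟩) (FormClass.mk ⟨Q₃, h₃⟩) C ↔
                  C = FormClass.mk ⟨Q₁', h₁⟩) ∧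
              (A.x₁ = 1 → BinForm.IsDirichletComposition Q₂ Q₃ Q₁'))) ∧
    (∃ P : List Instr, Instr.gcdCount P = 1 ∧
      ∀ β : ℤ → ℤ → ℤ → Fin 3 → ℤ, (∀ u v w : ℤ, IsBezoutTriple u v w (β u v w)) →
        ∀ (D : ℤ) (Q₂ Q₃ : BinForm), Q₂.IsPrimitive → Q₂.disc = D →
          Q₃.IsPrimitive → Q₃.disc = D → Q₃.a ≠ 0 →
          ∃ (A : Cube) (Q₁' : BinForm) (r : List ℤ),
            Instr.run β P [Q₂.a, Q₂.b, Q₂.c, Q₃.a, Q₃.b, Q₃.c] =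
              some (r ++ [A.x₁, A.x₂, A.x₃, A.x₄, A.y₁, A.y₂, A.y₃, A.y₄,
                Q₁'.a, Q₁'.b, Q₁'.c]) ∧
            IsArndtCube Q₂ Q₃ (β (-Q₃.a) (-Q₂.a) ((Q₂.b + Q₃.b) / 2)) A ∧
            (Q₂.a ≠ 0 → IsArndtForm D Q₂ Q₃ A.x₁ A.x₂ Q₁')) := by
  refine ⟨?_, Instr.arndtProgram, rfl, ?_⟩
  · rintro D Q₂ Q₃ ⟨h₂, rfl⟩ ⟨h₃, hD⟩ ha l hl
    have f₂ := arndtCube_form₂ hD.symm ha hl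
    have f₃ := arndtCube_form₃ hD.symm ha hl
    refine ⟨BinForm.even_b_add_b hD.symm, arndtCube Q₂ Q₃ l, isArndtCube_arndtCube hD.symm ha hl,
      f₂, f₃, fun ha₂ => ?_⟩
    have hc := (arndtCube Q₂ Q₃ l).isDirectComposition
    have hdisc := (arndtCube Q₂ Q₃ l).composedForm_disc
    rw [f₂, f₃] at hc
    rw [f₂] at hdisc
    exact ⟨(arndtCube Q₂ Q₃ l).composedForm, ⟨hc.isPrimitive h₂ h₃, hdisc⟩,
      isArndtForm_composedForm hD.symm ha hl ha₂,
      BinForm.IsDirectComposition.isSum_iff (f := ⟨Q₂, h₂, rfl⟩) (g := ⟨Q₃, h₃, hD⟩)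
        (F := ⟨(arndtCube Q₂ Q₃ l).composedForm, _⟩) hc,
      isDirichletComposition_composedForm hD.symm ha hl ha₂⟩
  · rintro β hβ D Q₂ Q₃ - rfl - hD ha
    obtain ⟨r, hr⟩ := Instr.run_arndtProgram β hD.symm ha rfl
    exact ⟨_, _, r, hr, isArndtCube_arndtCube hD.symm ha (hβ _ _ _),
      isArndtForm_composedForm hD.symm ha (hβ _ _ _)⟩
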